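/- Conventions. A unital Banach ring is a unital ring $R$ that is complete for a norm satisfying $\|x+y\|\le\|x\|+\|y\|$, $\|-x\|=\|x\|$, $\|xy\|\le\|x\|\,\|y\|$ and $\|1\|=1$; it is ultrametric if $\|x+y\|\le\max\{\|x\|,\|y\|\}$ for all $x,y$. A complete valuation field is a field $K$ that is complete for a norm with $|xy|_K=|x|_K|y|_K$ (the trivial one is allowed). For a commutative unital Banach ring $T$, $\mathcal M(T)$ is the set of non-zero multiplicative semi-norms $\lambda$ on $T$ with $\lambda(x)\le\|x\|$ for all $x\in T$, and $\mathbb A^1_{\mathbb Z_1}$ is the set of non-zero multiplicative semi-norms $\lambda$ on $\mathbb Z[\mathbf t]$ (automatically $\lambda(n)\le|n|$ for $n\in\mathbb Z$, with the Euclidean absolute value); both carry the topology of pointwise convergence. Fix an infinite cardinal $\alpha$, and let $\mathcal K$ be the class of complete valuation fields of cardinality at most $2^\alpha$. For $K_i\in\mathcal K$ and $s_i\in K_i$ ($i=1,2$), write $(K_1,s_1)\sim(K_2,s_2)$ if there are $K\in\mathcal K$, $s\in K$ and contractive unital ring homomorphisms $\varphi_i:K\to K_i$ with $\varphi_i(s)=s_i$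 ($i=1,2$). This is an equivalence relation; let $\tilde{\mathbb K}$ be the set of classes $(K,s)_\sim$, and let $\Theta:\tilde{\mathbb K}\to\mathbb A^1_{\mathbb Z_1}$ be the (well-defined) map sending $(K,s)_\sim$ to $\mathbf p\mapsto|\mathbf p(s)|_K$, through which $\tilde{\mathbb K}$ is identified with $\mathbb A^1_{\mathbb Z_1}$. For a unital Banach ring $R$ and $K\in\mathcal K$, let $R\hat\otimes_{\mathbb Z}K$ and $R\hat\otimes^{\mathrm{um}}_{\mathbb Z}K$ be the Hausdorff completions of the ring $R\otimes_{\mathbb Z}K$ for the semi-norms $$\|z\|_\wedge=\inf\sum_k\|a_k\|\,|b_k|_K\qquad\text{and}\qquad\|z\|^{\mathrm{um}}_\wedge=\inf\max_k\|a_k\|\,|b_k|_K ,$$ the infima being over all finite representations $z=\sum_k a_k\otimes b_k$. For $a\in R$, let $\sigma^{\mathrm{Ber}}_R(a)$ be the set of all $\tilde s\in\tilde{\mathbb K}$ for which there are $K\in\mathcal K$ and $s\in K$ with $\tilde s=(K,s)_\sim$ such that $R\hat\otimes_{\mathbb Z}K\neq(0)$ and $1\otimes s-a\otimes1$ is not invertible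 in $R\hat\otimes_{\mathbb Z}K$. Define $\sigma^{\mathrm{um}}_R(a)$ in the same way with $\hat\otimes^{\mathrm{um}}_{\mathbb Z}$ instead of $\hat\otimes_{\mathbb Z}$. **Proposition.** Let $T$ be a commutative unital Banach ring of cardinality at most $\alpha$, let $u\in T$, and define $\Phi_u:\mathcal M(T)\to\mathbb A^1_{\mathbb Z_1}$ by $\Phi_u(\lambda)(\mathbf p)=\lambda(\mathbf p(u))$ for $\lambda\in\mathcal M(T)$ and $\mathbf p\in\mathbb Z[\mathbf t]$. (a) $\Phi_u$ is continuous, $\Phi_u(\mathcal M(T))=\Theta(\sigma^{\mathrm{Ber}}_T(u))$, and $\sigma^{\mathrm{Ber}}_T(u)\neq\emptyset$. (b) If $T$ is generated by $u$ as a unital Banach ring (that is, the smallest closed unital subring of $T$ containing $u$ is $T$), then $\Phi_u$ is a homeomorphism from $\mathcal M(T)$ onto $\Theta(\sigma^{\mathrm{Ber}}_T(u))$. (c) If $T$ is ultrametric, then $\Phi_u(\mathcal M(T))=\Theta(\sigma^{\mathrm{um}}_T(u))$, and $\sigma^{\mathrm{um}}_T(u)=\sigma^{\mathrm{Ber}}_T(u)$.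 -/

import Mathlib

open scoped TensorProduct Polynomial Cardinal

universe u v

noncomputable section

namespace BanachSpec

/-! ### Auxiliary: a ring semi-norm defined as an infimum of costs -/

/-- If every `z : A` has a nonempty set `C z` of nonnegative costs, compatible with the ring
operations, then `z ↦ inf (C z)` is a submultiplicative semi-norm. -/
def infRingSeminorm {A : Type*} [Ring A] (C : A → Set ℝ)
    (hne : ∀ z, (C z).Nonempty) (hnn : ∀ z, ∀ r ∈ C z, 0 ≤ r) (h0 : (0 : ℝ) ∈ C 0)
    (hadd : ∀ x y, ∀ r ∈ C x, ∀ s ∈ C y, ∃ t ∈ C (x + y), t ≤ r + s)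
    (hneg : ∀ x, ∀ r ∈ C x, r ∈ C (-x))
    (hmul : ∀ x y, ∀ r ∈ C x, ∀ s ∈ C y, ∃ t ∈ C (x * y), t ≤ r * s) : RingSeminorm A where
  toFun z := sInf (C z)
  map_zero' := le_antisymm (csInf_le ⟨0, hnn 0⟩ h0) (le_csInf (hne 0) (hnn 0))
  add_le' x y := by
    have hb : ∀ z, BddBelow (C z) := fun z => ⟨0, hnn z⟩
    refine le_of_forall_pos_le_add fun ε hε => ?_
    obtain ⟨r, hr, hr'⟩ := exists_lt_of_csInf_lt (hne x) (lt_add_of_pos_right _ (half_pos hε))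
    obtain ⟨s, hs, hs'⟩ := exists_lt_of_csInf_lt (hne y) (lt_add_of_pos_right _ (half_pos hε))
    obtain ⟨t, ht, hts⟩ := hadd x y r hr s hs
    have := csInf_le (hb _) ht
    linarith
  neg' x := by
    have : C (-x) = C x := Set.Subset.antisymm
      (fun r hr => by simpa using hneg _ r hr) (fun r hr => hneg x r hr)
    simp [this]
  mul_le' x y := by
    have hb : ∀ z, BddBelow (C z) := fun z => ⟨0, hnn z⟩
    have h1 : ∀ r ∈ C x, ∀ s ∈ C y, sInf (C (x * y)) ≤ r * s := fun r hr s hs => by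
      obtain ⟨t, ht, hts⟩ := hmul x y r hr s hs
      exact (csInf_le (hb _) ht).trans hts
    have hx0 : 0 ≤ sInf (C x) := le_csInf (hne x) (hnn x)
    have hxt : Filter.Tendsto (fun ε : ℝ => (sInf (C x) + ε) * (sInf (C y) + ε))
        (nhdsWithin 0 (Set.Ioi 0)) (nhds (sInf (C x) * sInf (C y))) := by
      have : Continuous fun ε : ℝ => (sInf (C x) + ε) * (sInf (C y) + ε) := by fun_prop
      simpa using (this.tendsto 0).mono_left nhdsWithin_le_nhds
    refine ge_of_tendsto hxt ?_
    filter_upwards [self_mem_nhdsWithin] with ε hε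
    obtain ⟨r, hr, hr'⟩ := exists_lt_of_csInf_lt (hne x) (lt_add_of_pos_right _ hε)
    obtain ⟨s, hs, hs'⟩ := exists_lt_of_csInf_lt (hne y) (lt_add_of_pos_right _ hε)
    exact (h1 r hr s hs).trans
      (mul_le_mul hr'.le hs'.le (hnn y s hs) (add_nonneg hx0 (le_of_lt hε)))

/-! ### Completed tensor products over `ℤ` -/

section Tensor

variable (R : Type u) (S : Type v) [NormedRing R] [NormedRing S]

variable {R S} in
/-- The numbers `∑ᵢ ‖xᵢ‖ ‖yᵢ‖`, over all finite representations `z = ∑ᵢ xᵢ ⊗ yᵢ`. -/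
def sumCosts (z : R ⊗[ℤ] S) : Set ℝ :=
  {c | ∃ (ι : Type) (_ : Fintype ι) (x : ι → R) (y : ι → S),
    z = ∑ i, x i ⊗ₜ[ℤ] y i ∧ c = ∑ i, ‖x i‖ * ‖y i‖}

variable {R S} in
/-- The numbers `maxᵢ ‖xᵢ‖ ‖yᵢ‖`, over all finite representations `z = ∑ᵢ xᵢ ⊗ yᵢ`
(the maximum over the empty family being `0`). -/
def maxCosts (z : R ⊗[ℤ] S) : Set ℝ :=
  {c | ∃ (ι : Type) (_ : Fintype ι) (x : ι → R) (y : ι → S),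
    z = ∑ i, x i ⊗ₜ[ℤ] y i ∧ c = ⨆ i, ‖x i‖ * ‖y i‖}

variable {R S} in
theorem exists_rep (z : R ⊗[ℤ] S) : ∃ (ι : Type) (_ : Fintype ι) (x : ι → R) (y : ι → S),
    z = ∑ i, x i ⊗ₜ[ℤ] y i := by
  induction z with
  | zero => exact ⟨Empty, inferInstance, Empty.elim, Empty.elim, by simp⟩
  | tmul a b => exact ⟨Unit, inferInstance, fun _ => a, fun _ => b, by simp⟩
  | add z w hz hw =>
    obtain ⟨ι, _, x, y, rfl⟩ := hz
    obtain ⟨κ, _, x', y', rfl⟩ := hw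
    exact ⟨ι ⊕ κ, inferInstance, Sum.elim x x', Sum.elim y y', by simp⟩

/-- The projective tensor semi-norm `‖z‖_∧ = inf { ∑ᵢ ‖xᵢ‖ ‖yᵢ‖ : z = ∑ᵢ xᵢ ⊗ yᵢ }`. -/
def projSeminorm : RingSeminorm (R ⊗[ℤ] S) :=
  infRingSeminorm sumCosts
    (fun z => by
      obtain ⟨ι, _, x, y, h⟩ := exists_rep z
      exact ⟨_, ι, _, x, y, h, rfl⟩)
    (by
      rintro z r ⟨ι, _, x, y, -, rfl⟩
      positivity)
    ⟨Empty, inferInstance, Empty.elim, Empty.elim, by simp, by simp⟩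
    (by
      rintro z w r ⟨ι, _, x, y, rfl, rfl⟩ s ⟨κ, _, x', y', rfl, rfl⟩
      exact ⟨_, ⟨ι ⊕ κ, inferInstance, Sum.elim x x', Sum.elim y y', by simp, rfl⟩, by simp⟩)
    (by
      rintro z r ⟨ι, _, x, y, rfl, rfl⟩
      exact ⟨ι, inferInstance, fun i => -x i, y, by simp [TensorProduct.neg_tmul], by simp⟩)
    (by
      rintro z w r ⟨ι, _, x, y, rfl, rfl⟩ s ⟨κ, _, x', y', rfl, rfl⟩
      refine ⟨_, ⟨ι × κ, inferInstance, fun p => x p.1 * x' p.2, fun p => y p.1 * y' p.2,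
        ?_, rfl⟩, ?_⟩
      · simp [Finset.sum_mul_sum, Fintype.sum_prod_type]
      · rw [Finset.sum_mul_sum, Fintype.sum_prod_type]
        refine Finset.sum_le_sum fun i _ => Finset.sum_le_sum fun j _ => ?_
        calc ‖x i * x' j‖ * ‖y i * y' j‖ ≤ (‖x i‖ * ‖x' j‖) * (‖y i‖ * ‖y' j‖) := by
              gcongr <;> exact norm_mul_le _ _
          _ = _ := by ring)

/-- The ultrametric tensor semi-norm `‖z‖_∧^um = inf { maxᵢ ‖xᵢ‖ ‖yᵢ‖ : z = ∑ᵢ xᵢ ⊗ yᵢ }`. -/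
def ultraSeminorm : RingSeminorm (R ⊗[ℤ] S) :=
  infRingSeminorm maxCosts
    (fun z => by
      obtain ⟨ι, _, x, y, h⟩ := exists_rep z
      exact ⟨_, ι, _, x, y, h, rfl⟩)
    (by
      rintro z r ⟨ι, _, x, y, -, rfl⟩
      exact Real.iSup_nonneg fun i => by positivity)
    ⟨Empty, inferInstance, Empty.elim, Empty.elim, by simp, by simp⟩
    (by
      rintro z w r ⟨ι, _, x, y, rfl, rfl⟩ s ⟨κ, _, x', y', rfl, rfl⟩
      refine ⟨_, ⟨ι ⊕ κ, inferInstance, Sum.elim x x', Sum.elim y y', by simp, rfl⟩, ?_⟩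
      have h1 : 0 ≤ ⨆ i, ‖x i‖ * ‖y i‖ := Real.iSup_nonneg fun i => by positivity
      have h2 : 0 ≤ ⨆ i, ‖x' i‖ * ‖y' i‖ := Real.iSup_nonneg fun i => by positivity
      refine Real.iSup_le ?_ (add_nonneg h1 h2)
      rintro (i | j)
      · exact (le_ciSup (f := fun i => ‖x i‖ * ‖y i‖) (Set.finite_range _).bddAbove i).trans
          (le_add_of_nonneg_right h2)
      · exact (le_ciSup (f := fun i => ‖x' i‖ * ‖y' i‖) (Set.finite_range _).bddAbove j).trans
          (le_add_of_nonneg_left h1))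
    (by
      rintro z r ⟨ι, _, x, y, rfl, rfl⟩
      exact ⟨ι, inferInstance, fun i => -x i, y, by simp [TensorProduct.neg_tmul], by simp⟩)
    (by
      rintro z w r ⟨ι, _, x, y, rfl, rfl⟩ s ⟨κ, _, x', y', rfl, rfl⟩
      refine ⟨_, ⟨ι × κ, inferInstance, fun p => x p.1 * x' p.2, fun p => y p.1 * y' p.2,
        ?_, rfl⟩, ?_⟩
      · simp [Finset.sum_mul_sum, Fintype.sum_prod_type]
      · have h1 : 0 ≤ ⨆ i, ‖x i‖ * ‖y i‖ := Real.iSup_nonneg fun i => by positivity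
        have h2 : 0 ≤ ⨆ i, ‖x' i‖ * ‖y' i‖ := Real.iSup_nonneg fun i => by positivity
        refine Real.iSup_le ?_ (mul_nonneg h1 h2)
        rintro ⟨i, j⟩
        calc ‖x i * x' j‖ * ‖y i * y' j‖ ≤ (‖x i‖ * ‖x' j‖) * (‖y i‖ * ‖y' j‖) := by
              gcongr <;> exact norm_mul_le _ _
          _ = (‖x i‖ * ‖y i‖) * (‖x' j‖ * ‖y' j‖) := by ring
          _ ≤ _ := mul_le_mul
              (le_ciSup (f := fun i => ‖x i‖ * ‖y i‖) (Set.finite_range _).bddAbove i)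
              (le_ciSup (f := fun i => ‖x' i‖ * ‖y' i‖) (Set.finite_range _).bddAbove j)
              (by positivity) h1)

/-- The ring `R ⊗_ℤ S`, endowed with the semi-norm `‖·‖_∧`. -/
def ProjTensor : Type (max u v) := R ⊗[ℤ] S

instance : Ring (ProjTensor R S) := inferInstanceAs (Ring (R ⊗[ℤ] S))

instance : SeminormedRing (ProjTensor R S) :=
  (show RingSeminorm (ProjTensor R S) from projSeminorm R S).toSeminormedRing

/-- The ring `R ⊗_ℤ S`, endowed with the semi-norm `‖·‖_∧^um`. -/
def UltraTensor : Type (max u v) := R ⊗[ℤ] S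

instance : Ring (UltraTensor R S) := inferInstanceAs (Ring (R ⊗[ℤ] S))

instance : SeminormedRing (UltraTensor R S) :=
  (show RingSeminorm (UltraTensor R S) from ultraSeminorm R S).toSeminormedRing

/-- The completed projective tensor product `R ⊗̂_ℤ S`: Mathlib's `Completion` is the Hausdorff
completion, i.e. the completion of the quotient by the kernel of the semi-norm. -/
abbrev CompletedTensor : Type (max u v) := UniformSpace.Completion (ProjTensor R S)

/-- The completed ultrametric tensor product `R ⊗̂_ℤ^um S`. -/
abbrev CompletedUltraTensor : Type (max u v) := UniformSpace.Completion (UltraTensor R S)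

variable {R S}

/-- The image of `x ⊗ y` in `R ⊗̂_ℤ S`. -/
def CompletedTensor.tmul (x : R) (y : S) : CompletedTensor R S :=
  ((show ProjTensor R S from x ⊗ₜ[ℤ] y : ProjTensor R S) : CompletedTensor R S)

/-- The image of `x ⊗ y` in `R ⊗̂_ℤ^um S`. -/
def CompletedUltraTensor.tmul (x : R) (y : S) : CompletedUltraTensor R S :=
  ((show UltraTensor R S from x ⊗ₜ[ℤ] y : UltraTensor R S) : CompletedUltraTensor R S)

end Tensor

/-! ### Spaces of multiplicative semi-norms

Mathlib's `MulRingSeminorm` is a semi-norm `f` with `f (x * y) = f x * f y` and `f 1 = 1`, i.e. a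
non-zero multiplicative semi-norm. -/

/-- The space `𝓜(T)` of contractive non-zero multiplicative semi-norms on `T`. -/
def BerkovichSpace (T : Type u) [NormedCommRing T] : Type u :=
  {f : MulRingSeminorm T // ∀ x, f x ≤ ‖x‖}

/-- The topology of pointwise convergence. -/
instance (T : Type u) [NormedCommRing T] : TopologicalSpace (BerkovichSpace T) :=
  TopologicalSpace.induced (fun (f : BerkovichSpace T) (x : T) => f.1 x) inferInstance

/-- The affine analytic line `𝔸¹_T`: non-zero multiplicative semi-norms on `T[X]` that are
contractive on `T`. Mathlib's norm on `ℤ` is the Euclidean one, so `AffineLine ℤ` is the affine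
analytic line over `ℤ` with the Euclidean norm. -/
def AffineLine (T : Type u) [NormedCommRing T] : Type u :=
  {f : MulRingSeminorm T[X] // ∀ x : T, f (Polynomial.C x) ≤ ‖x‖}

/-- The topology of pointwise convergence. -/
instance (T : Type u) [NormedCommRing T] : TopologicalSpace (AffineLine T) :=
  TopologicalSpace.induced (fun (f : AffineLine T) (p : T[X]) => f.1 p) inferInstance

/-- The semi-norm `p ↦ f (p(u))` on `ℤ[X]`, for a contractive multiplicative semi-norm `f`. -/
def evalSeminorm {T : Type u} [NormedCommRing T] [NormOneClass T] (f : MulRingSeminorm T)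
    (hf : ∀ x, f x ≤ ‖x‖) (u : T) : AffineLine ℤ :=
  ⟨{ toFun := fun p => f (Polynomial.aeval u p)
     map_zero' := by simp
     add_le' := fun p q => by simpa using map_add_le_add f _ _
     neg' := fun p => by simp
     map_one' := by simp
     map_mul' := fun p q => by simp },
   fun n => by
    change f (Polynomial.aeval u (Polynomial.C n)) ≤ ‖n‖
    rw [Polynomial.aeval_C, eq_intCast]
    refine (hf _).trans ?_
    obtain ⟨m, rfl | rfl⟩ := n.eq_nat_or_neg <;> simpa using Nat.norm_cast_le (α := T) m⟩

/-- The map `Φ_u : 𝓜(T) → 𝔸¹_ℤ`, `Φ_u(f)(p) = f (p(u))`. -/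
def Phi {T : Type u} [NormedCommRing T] [NormOneClass T] (u : T) (f : BerkovichSpace T) :
    AffineLine ℤ :=
  evalSeminorm f.1 f.2 u

/-! ### The universal space of scalars -/

/-- A pair `(K, s)` of a complete valuation field `K` (a field that is complete for a
multiplicative norm, possibly trivial) with at most `2 ^ α` elements, and an element `s` of `K`. -/
structure PointedField (α : Cardinal.{u}) : Type (u + 1) where
  carrier : Type u
  [normedField : NormedField carrier]
  [complete : CompleteSpace carrier]
  card_le : #carrier ≤ 2 ^ α
  point : carrier

attribute [instance] PointedField.normedField PointedField.complete

/-- `(K₁, s₁) ∼ (K₂, s₂)`: there are `(K, s)` and contractive unital ring homomorphisms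
`K → K₁`, `K → K₂` with `s ↦ s₁` and `s ↦ s₂`. -/
def PointedField.Equivalent {α : Cardinal.{u}} (x₁ x₂ : PointedField α) : Prop :=
  ∃ (x : PointedField α) (f₁ : x.carrier →+* x₁.carrier) (f₂ : x.carrier →+* x₂.carrier),
    (∀ t, ‖f₁ t‖ ≤ ‖t‖) ∧ (∀ t, ‖f₂ t‖ ≤ ‖t‖) ∧ f₁ x.point = x₁.point ∧ f₂ x.point = x₂.point

theorem norm_map_eq {K L : Type*} [NormedField K] [NormedField L] (f : K →+* L)
    (hf : ∀ t, ‖f t‖ ≤ ‖t‖) (t : K) : ‖f t‖ = ‖t‖ := by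
  refine le_antisymm (hf t) ?_
  rcases eq_or_ne t 0 with rfl | ht
  · simp
  · have h := hf t⁻¹
    rw [map_inv₀, norm_inv, norm_inv] at h
    exact (inv_le_inv₀ (norm_pos_iff.2 ((map_ne_zero f).2 ht)) (norm_pos_iff.2 ht)).1 h

/-- The relation `∼` is transitive: if `(K₁, s₁)` and `(K₂, s₂)` are joined through `K`, and
`(K₂, s₂)` and `(K₃, s₃)` through `L`, then `(K₁, s₁)` and `(K₃, s₃)` are joined through the
intersection of the images of `K` and `L` in `K₂`. -/
theorem PointedField.equivalence (α : Cardinal.{u}) :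
    Equivalence (PointedField.Equivalent (α := α)) where
  refl x := ⟨x, RingHom.id _, RingHom.id _, by simp, by simp, rfl, rfl⟩
  symm := fun ⟨x, f₁, f₂, h₁, h₂, e₁, e₂⟩ => ⟨x, f₂, f₁, h₂, h₁, e₂, e₁⟩
  trans := by
    rintro x₁ x₂ x₃ ⟨x, f₁, f₂, h₁, h₂, e₁, e₂⟩ ⟨y, g₂, g₃, k₂, k₃, d₂, d₃⟩
    have hc : ∀ (z : PointedField α) (h : z.carrier →+* x₂.carrier), (∀ t, ‖h t‖ ≤ ‖t‖) →
        IsClosed (h.fieldRange : Set x₂.carrier) := fun z h hh => by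
      have hi : Isometry h := AddMonoidHomClass.isometry_of_norm h (norm_map_eq h hh)
      rw [RingHom.coe_fieldRange]
      exact hi.isClosedEmbedding.isClosed_range
    let M : Subfield x₂.carrier := f₂.fieldRange ⊓ g₂.fieldRange
    have hM : IsClosed (M : Set x₂.carrier) := (hc x f₂ h₂).inter (hc y g₂ k₂)
    have : CompleteSpace M := hM.completeSpace_coe
    have hx : x₂.point ∈ M := ⟨⟨x.point, e₂⟩, ⟨y.point, d₂⟩⟩
    have inv : ∀ (z w : PointedField α) (h : z.carrier →+* x₂.carrier)
        (k : z.carrier →+* w.carrier), (∀ t, ‖h t‖ ≤ ‖t‖) → (∀ t, ‖k t‖ ≤ ‖t‖) →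
        h z.point = x₂.point → k z.point = w.point → M ≤ h.fieldRange →
        ∃ q : M →+* w.carrier, (∀ t, ‖q t‖ ≤ ‖t‖) ∧ q ⟨x₂.point, hx⟩ = w.point := by
      intro z w h k hh hk eh ek hle
      let e : z.carrier ≃+* h.fieldRange := h.rangeRestrictFieldEquiv
      have he : ∀ t, h (e.symm t) = t := fun t => congrArg Subtype.val (e.apply_symm_apply t)
      refine ⟨k.comp ((e.symm : h.fieldRange →+* z.carrier).comp (Subfield.inclusion hle)),
        fun t => ?_, ?_⟩
      · change ‖k (e.symm (Subfield.inclusion hle t))‖ ≤ ‖t‖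
        rw [norm_map_eq k hk, ← norm_map_eq h hh, he]
        rfl
      · change k (e.symm (Subfield.inclusion hle ⟨x₂.point, hx⟩)) = w.point
        rw [← ek]
        congr 1
        apply h.injective
        rw [he, eh]
        rfl
    obtain ⟨q₁, a₁, b₁⟩ := inv x x₁ f₂ f₁ h₂ h₁ e₂ e₁ inf_le_left
    obtain ⟨q₃, a₃, b₃⟩ := inv y x₃ g₂ g₃ k₂ k₃ d₂ d₃ inf_le_right
    exact ⟨⟨M, (Cardinal.mk_le_of_injective Subtype.val_injective).trans x₂.card_le,
      ⟨x₂.point, hx⟩⟩, q₁, q₃, a₁, a₃, b₁, b₃⟩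

instance PointedField.setoid (α : Cardinal.{u}) : Setoid (PointedField α) :=
  ⟨PointedField.Equivalent, PointedField.equivalence α⟩

/-- The set `𝕂̃` of equivalence classes `(K, s)_∼`. -/
def Scalars (α : Cardinal.{u}) : Type (u + 1) := Quotient (PointedField.setoid α)

/-- The class `(K, s)_∼`. -/
def Scalars.mk {α : Cardinal.{u}} (x : PointedField α) : Scalars α := Quotient.mk _ x

/-- The map `Θ : 𝕂̃ → 𝔸¹_ℤ` sending `(K, s)_∼` to `p ↦ |p(s)|_K`. -/
def Scalars.toAffineLine {α : Cardinal.{u}} : Scalars α → AffineLine ℤ :=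
  Quotient.lift
    (fun x => evalSeminorm
      { toFun := fun t : x.carrier => ‖t‖
        map_zero' := norm_zero
        add_le' := norm_add_le
        neg' := norm_neg
        map_one' := norm_one
        map_mul' := norm_mul } (fun _ => le_rfl) x.point)
    (by
      rintro x₁ x₂ ⟨x, f₁, f₂, h₁, h₂, e₁, e₂⟩
      refine Subtype.ext (DFunLike.ext _ _ fun p => ?_)
      change ‖Polynomial.aeval x₁.point p‖ = ‖Polynomial.aeval x₂.point p‖
      have key : ∀ (L : Type u) [NormedField L] (f : x.carrier →+* L), (∀ t, ‖f t‖ ≤ ‖t‖) →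
          ‖Polynomial.aeval (f x.point) p‖ = ‖Polynomial.aeval x.point p‖ := fun L _ f hf => by
        rw [← norm_map_eq f hf]
        exact congrArg norm (Polynomial.aeval_algHom_apply f.toIntAlgHom x.point p)
      rw [← e₁, ← e₂, key _ f₁ h₁, key _ f₂ h₂])

/-! ### Spectra of elements of Banach rings -/

section Spectra

variable (α : Cardinal.{u}) {R : Type u} [NormedRing R]

/-- The Berkovich spectrum `σ^Ber_R(a)`: the classes `(K, s)_∼` such that `R ⊗̂_ℤ K ≠ 0` and
`1 ⊗ s - a ⊗ 1` is not invertible in `R ⊗̂_ℤ K`. -/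
def berSpectrum (a : R) : Set (Scalars α) :=
  {c | ∃ x : PointedField α, Scalars.mk x = c ∧ Nontrivial (CompletedTensor R x.carrier) ∧
    ¬ IsUnit (CompletedTensor.tmul (1 : R) x.point - CompletedTensor.tmul a (1 : x.carrier))}

/-- The ultrametric spectrum `σ^um_R(a)`: the classes `(K, s)_∼` such that `R ⊗̂_ℤ^um K ≠ 0` and
`1 ⊗ s - a ⊗ 1` is not invertible in `R ⊗̂_ℤ^um K`. -/
def umSpectrum (a : R) : Set (Scalars α) :=
  {c | ∃ x : PointedField α, Scalars.mk x = c ∧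
    Nontrivial (CompletedUltraTensor R x.carrier) ∧
    ¬ IsUnit (CompletedUltraTensor.tmul (1 : R) x.point -
      CompletedUltraTensor.tmul a (1 : x.carrier))}

end Spectra

end BanachSpec

end

namespace BanachSpec

/-! ### Multiplicative semi-norms below a given ring semi-norm -/

section Multiplicative

/-! The theorem matches non-invertibility of `1 ⊗ s - u ⊗ 1` with contractive multiplicative
semi-norms on `T`. From `f ∈ 𝓜(T)` to the spectrum: let `K` be the completed residue field of `f`,
with character `χ : T → K` (`exists_pointedField`). The map `x ⊗ y ↦ χ x * y` is bounded by the
tensor semi-norm and kills `1 ⊗ χ u - u ⊗ 1`, so this element generates an ideal at distance at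
least `1` from `1` and is not invertible. Here `‖p(χ u)‖ = f (p(u))`. From the spectrum to `𝓜(T)`:
if `1 ⊗ s - u ⊗ 1` is not invertible, Berkovich's non-emptiness argument
(`exists_mulRingSeminorm_le`) gives a multiplicative semi-norm on `T ⊗ K` below the tensor semi-norm
and zero at this element. Its restriction to `K` has to be the norm, its restriction `f` to `T` lies
in `𝓜(T)`, and `f (p(u)) = ‖p(s)‖` because `u` and `s` agree modulo the kernel. Only the bound on
elementary tensors enters the second direction, so it also serves the ultrametric tensor product; in
the first one, `K` is ultrametric when `T` is. Both spectra thus have the same image under `Θ`, and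
injectivity of `Θ` (`toAffineLine_injective`) makes them equal. For (b), density of the integral
polynomials in `u` determines both the points of `𝓜(T)` and its topology. -/

theorem infRingSeminorm_le {A : Type*} [Ring A] {C : A → Set ℝ} {hne hnn h0 hadd hneg hmul}
    {z : A} {r : ℝ} (hr : r ∈ C z) : infRingSeminorm C hne hnn h0 hadd hneg hmul z ≤ r :=
  csInf_le ⟨0, hnn z⟩ hr

theorem le_infRingSeminorm {A : Type*} [Ring A] {C : A → Set ℝ} {hne hnn h0 hadd hneg hmul}
    {z : A} {b : ℝ} (hb : ∀ r ∈ C z, b ≤ r) : b ≤ infRingSeminorm C hne hnn h0 hadd hneg hmul z :=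
  le_csInf (hne z) hb

variable {A : Type*} [CommRing A]

/-- Below every ring semi-norm `N` with `N 1 = 1` there is a minimal one. -/
theorem exists_minimal_ringSeminorm (N : RingSeminorm A) (h1 : N 1 = 1) :
    ∃ f : RingSeminorm A, f 1 = 1 ∧ (∀ x, f x ≤ N x) ∧
      ∀ g : RingSeminorm A, g 1 = 1 → (∀ x, g x ≤ f x) → ∀ x, f x ≤ g x := by
  let X := {f : RingSeminorm A // f 1 = 1 ∧ ∀ x, f x ≤ N x}
  -- Zorn's lemma for the reversed order: a chain needs a lower bound that still takes the value `1`
  -- at `1`.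
  suffices hX : ∀ c : Set X, IsChain (fun f g : X => ∀ x, g.1 x ≤ f.1 x) c →
      ∃ g : X, ∀ f ∈ c, ∀ x, g.1 x ≤ f.1 x by
    obtain ⟨⟨f, hf1, hfN⟩, hf⟩ := exists_maximal_of_chains_bounded hX
      (fun hab hbc x => (hbc x).trans (hab x))
    exact ⟨f, hf1, hfN, fun g hg hgf => hf ⟨g, hg, fun x => (hgf x).trans (hfN x)⟩ hgf⟩
  intro c hc
  rcases c.eq_empty_or_nonempty with rfl | ⟨f₀, hf₀⟩
  · exact ⟨⟨N, h1, fun _ => le_rfl⟩, by simp⟩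
  -- The lower bound is the pointwise infimum. Two values at different points are attained by
  -- different members of the chain, so a common smaller member is needed for subadditivity and
  -- submultiplicativity.
  have hdir : ∀ f ∈ c, ∀ g ∈ c, ∃ h ∈ c, (∀ x, h.1 x ≤ f.1 x) ∧ ∀ x, h.1 x ≤ g.1 x := by
    intro f hf g hg
    rcases eq_or_ne f g with rfl | hne
    · exact ⟨f, hf, fun _ => le_rfl, fun _ => le_rfl⟩
    rcases hc hf hg hne with h | h
    · exact ⟨g, hg, h, fun _ => le_rfl⟩
    · exact ⟨f, hf, fun _ => le_rfl, h⟩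
  let g : RingSeminorm A := infRingSeminorm (fun x => {r | ∃ f ∈ c, r = f.1 x})
    (fun x => ⟨_, f₀, hf₀, rfl⟩)
    (by rintro x r ⟨f, -, rfl⟩; exact apply_nonneg f.1 x)
    ⟨f₀, hf₀, (map_zero f₀.1).symm⟩
    (by
      rintro x y r ⟨f, hf, rfl⟩ s ⟨g, hg, rfl⟩
      obtain ⟨h, hh, hhf, hhg⟩ := hdir f hf g hg
      exact ⟨_, ⟨h, hh, rfl⟩, (map_add_le_add h.1 x y).trans (add_le_add (hhf x) (hhg y))⟩)
    (by rintro x r ⟨f, hf, rfl⟩; exact ⟨f, hf, (map_neg_eq_map f.1 x).symm⟩)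
    (by
      rintro x y r ⟨f, hf, rfl⟩ s ⟨g, hg, rfl⟩
      obtain ⟨h, hh, hhf, hhg⟩ := hdir f hf g hg
      exact ⟨_, ⟨h, hh, rfl⟩, (map_mul_le_mul h.1 x y).trans
        (mul_le_mul (hhf x) (hhg y) (apply_nonneg _ _) (apply_nonneg _ _))⟩)
  have hg : ∀ f ∈ c, ∀ x, g x ≤ f.1 x := fun f hf x => infRingSeminorm_le ⟨f, hf, rfl⟩
  refine ⟨⟨g, le_antisymm ((hg f₀ hf₀ 1).trans_eq f₀.2.1) (le_infRingSeminorm ?_),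
    fun x => (hg f₀ hf₀ x).trans (f₀.2.2 x)⟩, hg⟩
  rintro r ⟨f, -, rfl⟩
  exact f.2.1.ge

/-- The growth rates of the powers of `x`: the infimum of this set is the spectral radius. -/
def growthRates (f : RingSeminorm A) (x : A) : Set ℝ :=
  {r | 0 ≤ r ∧ ∃ C, 0 ≤ C ∧ ∀ k : ℕ, f (x ^ k) ≤ C * r ^ k}

theorem map_pow_le_pow_of_map_one (f : RingSeminorm A) (h1 : f 1 = 1) (x : A) (k : ℕ) :
    f (x ^ k) ≤ f x ^ k := by
  induction k with
  | zero => simp [h1]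
  | succ k ih =>
    rw [pow_succ, pow_succ]
    exact (map_mul_le_mul f _ _).trans (mul_le_mul_of_nonneg_right ih (apply_nonneg _ _))

theorem apply_mem_growthRates (f : RingSeminorm A) (h1 : f 1 = 1) (x : A) :
    f x ∈ growthRates f x :=
  ⟨apply_nonneg _ _, 1, zero_le_one, fun k => by
    rw [one_mul]; exact map_pow_le_pow_of_map_one f h1 x k⟩

theorem natCast_mul_le (f : RingSeminorm A) (n : ℕ) (x : A) : f (n * x) ≤ n * f x := by
  induction n with
  | zero => simp
  | succ n ih =>
    rw [Nat.cast_succ, Nat.cast_succ, add_mul, add_mul, one_mul, one_mul]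
    exact (map_add_le_add f _ _).trans (add_le_add_left ih _)

/-- The spectral semi-norm of a ring semi-norm `f` with `f 1 = 1`. -/
noncomputable def spectralSeminorm (f : RingSeminorm A) (h1 : f 1 = 1) : RingSeminorm A :=
  infRingSeminorm (growthRates f)
    (fun x => ⟨_, apply_mem_growthRates f h1 x⟩)
    (fun _ _ hr => hr.1)
    (by simpa using apply_mem_growthRates f h1 0)
    (by
      rintro x y r ⟨hr, C, hC, hx⟩ s ⟨hs, D, hD, hy⟩
      refine ⟨r + s, ⟨add_nonneg hr hs, C * D, mul_nonneg hC hD, fun k => ?_⟩, le_rfl⟩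
      -- Binomial expansion, available because `A` is commutative; an integer coefficient costs at
      -- most its own value by `natCast_mul_le`.
      rw [add_pow, add_pow, Finset.mul_sum]
      refine (Finset.le_sum_of_subadditive f (map_zero f).le (map_add_le_add f) _ _).trans
        (Finset.sum_le_sum fun m _ => ?_)
      calc f (x ^ m * y ^ (k - m) * (k.choose m : A))
          = f ((k.choose m : A) * (x ^ m * y ^ (k - m))) := by rw [mul_comm]
        _ ≤ k.choose m * (f (x ^ m) * f (y ^ (k - m))) :=
            (natCast_mul_le f _ _).trans
              (mul_le_mul_of_nonneg_left (map_mul_le_mul f _ _) (Nat.cast_nonneg _))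
        _ ≤ k.choose m * ((C * r ^ m) * (D * s ^ (k - m))) := by
            refine mul_le_mul_of_nonneg_left (mul_le_mul (hx m) (hy _) (apply_nonneg _ _) ?_)
              (Nat.cast_nonneg _)
            positivity
        _ = C * D * (r ^ m * s ^ (k - m) * (k.choose m : ℝ)) := by ring)
    (by
      rintro x r ⟨hr, C, hC, hx⟩
      refine ⟨hr, C, hC, fun k => ?_⟩
      rcases k.even_or_odd with h | h
      · rw [h.neg_pow]; exact hx k
      · rw [h.neg_pow, map_neg_eq_map]; exact hx k)
    (by
      rintro x y r ⟨hr, C, hC, hx⟩ s ⟨hs, D, hD, hy⟩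
      refine ⟨r * s, ⟨mul_nonneg hr hs, C * D, mul_nonneg hC hD, fun k => ?_⟩, le_rfl⟩
      rw [mul_pow, mul_pow]
      calc f (x ^ k * y ^ k) ≤ (C * r ^ k) * (D * s ^ k) :=
            (map_mul_le_mul f _ _).trans
              (mul_le_mul (hx k) (hy k) (apply_nonneg _ _) (by positivity))
        _ = _ := by ring)

theorem spectralSeminorm_le (f : RingSeminorm A) (h1 : f 1 = 1) (x : A) :
    spectralSeminorm f h1 x ≤ f x :=
  infRingSeminorm_le (apply_mem_growthRates f h1 x)

theorem spectralSeminorm_one (f : RingSeminorm A) (h1 : f 1 = 1) :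
    spectralSeminorm f h1 1 = 1 := by
  refine le_antisymm ((spectralSeminorm_le f h1 1).trans_eq h1) (le_infRingSeminorm ?_)
  rintro r ⟨hr, C, hC, h⟩
  by_contra! hlt
  have h0 : Filter.Tendsto (fun k : ℕ => C * r ^ k) Filter.atTop (nhds 0) := by
    simpa using (tendsto_pow_atTop_nhds_zero_of_lt_one hr hlt).const_mul C
  have : (1 : ℝ) ≤ 0 := ge_of_tendsto' h0 fun k => by simpa [h1] using h k
  linarith

/-- Division of `k` by `n` reduces the growth of `x ^ k` to the powers of `x ^ n` and finitely many
remainders. The sum over all remainders is a constant that works for every `k`. -/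
theorem mem_growthRates_of_pow (f : RingSeminorm A) (h1 : f 1 = 1) {x : A} {n : ℕ} (hn : 0 < n)
    {s : ℝ} (hs : 0 < s) (h : f (x ^ n) ≤ s ^ n) : s ∈ growthRates f x := by
  refine ⟨hs.le, ∑ j ∈ Finset.range n, f (x ^ j) / s ^ j,
    Finset.sum_nonneg fun j _ => div_nonneg (apply_nonneg _ _) (by positivity), fun k => ?_⟩
  have hle : f (x ^ (k % n)) / s ^ (k % n) ≤ ∑ j ∈ Finset.range n, f (x ^ j) / s ^ j :=
    Finset.single_le_sum (f := fun j => f (x ^ j) / s ^ j)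
      (fun j _ => div_nonneg (apply_nonneg _ _) (by positivity))
      (Finset.mem_range.2 (Nat.mod_lt k hn))
  calc f (x ^ k) = f ((x ^ n) ^ (k / n) * x ^ (k % n)) := by
        rw [← pow_mul, ← pow_add, Nat.div_add_mod]
    _ ≤ (s ^ n) ^ (k / n) * f (x ^ (k % n)) :=
        (map_mul_le_mul f _ _).trans (mul_le_mul_of_nonneg_right
          ((map_pow_le_pow_of_map_one f h1 _ _).trans
            (pow_le_pow_left₀ (apply_nonneg _ _) h _)) (apply_nonneg _ _))
    _ = f (x ^ (k % n)) / s ^ (k % n) * s ^ k := by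
        conv_rhs => rw [← Nat.div_add_mod k n, pow_add, pow_mul]
        rw [Nat.div_add_mod]
        field_simp
    _ ≤ _ := mul_le_mul_of_nonneg_right hle (by positivity)

/-- A minimal ring semi-norm is multiplicative. -/
theorem map_mul_of_minimal (f : RingSeminorm A) (h1 : f 1 = 1)
    (hmin : ∀ g : RingSeminorm A, g 1 = 1 → (∀ x, g x ≤ f x) → ∀ x, f x ≤ g x) (x y : A) :
    f (x * y) = f x * f y := by
  -- By minimality `f` equals its spectral semi-norm. If `f (a ^ n) < f a ^ n`, some `s` slightly
  -- below `f a` is still a growth rate of `a`, a contradiction.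
  have hpm : IsPowMul f := by
    intro a n hn
    refine le_antisymm (map_pow_le_pow_of_map_one f h1 a n) ?_
    by_contra! hlt
    have hc : Filter.Tendsto (fun t : ℝ => t ^ n) (nhdsWithin (f a) (Set.Iio (f a)))
        (nhds (f a ^ n)) := ((continuous_pow n).tendsto _).mono_left nhdsWithin_le_nhds
    have ha : 0 < f a := (apply_nonneg f a).lt_of_ne' fun h0 => by
      rw [h0, zero_pow (by omega)] at hlt
      exact absurd hlt (apply_nonneg f _).not_gt
    obtain ⟨s, hs, hs0, hsa⟩ := ((hc.eventually (lt_mem_nhds hlt)).and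
      (Ioo_mem_nhdsLT ha)).exists
    have hsp : spectralSeminorm f h1 a ≤ s :=
      infRingSeminorm_le (mem_growthRates_of_pow f h1 hn hs0 hs.le)
    exact hsa.not_ge ((hmin _ (spectralSeminorm_one f h1) (spectralSeminorm_le f h1) a).trans hsp)
  rcases eq_or_ne (f x) 0 with hx | hx
  · rw [hx, zero_mul]
    exact le_antisymm ((map_mul_le_mul f x y).trans_eq (by rw [hx, zero_mul])) (apply_nonneg _ _)
  -- The limit of `f (z * x ^ n) / f x ^ n` is a ring semi-norm below `f` for which multiplication
  -- by `x` is exactly multiplicative. Minimality identifies it with `f`.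
  · have hle : ∀ z, f z ≤ seminormFromConst' x f z := hmin (seminormFromConst h1.le hx hpm)
      (seminormFromConst_one h1.le hx hpm) (seminormFromConst_le_seminorm h1.le hx hpm)
    have heq : ∀ z, seminormFromConst' x f z = f z := fun z =>
      le_antisymm (seminormFromConst_le_seminorm h1.le hx hpm z) (hle z)
    simpa only [heq] using seminormFromConst_const_mul h1.le hx hpm y

/-- The quotient semi-norm for the ideal generated by `z`. -/
noncomputable def quotientSeminorm (N : RingSeminorm A) (z : A) : RingSeminorm A :=
  infRingSeminorm (fun x => {r | ∃ w, r = N (x - z * w)})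
    (fun x => ⟨_, 0, rfl⟩)
    (by rintro x r ⟨w, rfl⟩; exact apply_nonneg _ _)
    ⟨0, by simp⟩
    (by
      rintro x y r ⟨w, rfl⟩ s ⟨w', rfl⟩
      refine ⟨_, ⟨w + w', rfl⟩, ?_⟩
      rw [show x + y - z * (w + w') = (x - z * w) + (y - z * w') by ring]
      exact map_add_le_add N _ _)
    (by
      rintro x r ⟨w, rfl⟩
      refine ⟨-w, ?_⟩
      rw [show -x - z * -w = -(x - z * w) by ring, map_neg_eq_map])
    (by
      rintro x y r ⟨w, rfl⟩ s ⟨w', rfl⟩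
      refine ⟨_, ⟨w * y + x * w' - z * w * w', rfl⟩, ?_⟩
      rw [show x * y - z * (w * y + x * w' - z * w * w') = (x - z * w) * (y - z * w') by ring]
      exact map_mul_le_mul N _ _)

/-- If no element of the ideal `(z)` is at distance less than `1` from `1`, then there is a
multiplicative semi-norm bounded by `N` and vanishing at `z`. -/
theorem exists_mulRingSeminorm_le (N : RingSeminorm A) (h1 : N 1 ≤ 1) (z : A)
    (hz : ∀ w, 1 ≤ N (1 - z * w)) :
    ∃ f : MulRingSeminorm A, (∀ x, f x ≤ N x) ∧ f z = 0 := by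
  have hle : ∀ x, quotientSeminorm N z x ≤ N x := fun x =>
    infRingSeminorm_le ⟨0, by simp⟩
  have hq1 : quotientSeminorm N z 1 = 1 := by
    refine le_antisymm ((hle 1).trans h1) (le_infRingSeminorm ?_)
    rintro r ⟨w, rfl⟩
    exact hz w
  have hqz : quotientSeminorm N z z ≤ 0 := infRingSeminorm_le ⟨1, by simp⟩
  obtain ⟨f, hf1, hf, hmin⟩ := exists_minimal_ringSeminorm _ hq1
  exact ⟨{ f with map_one' := hf1, map_mul' := map_mul_of_minimal f hf1 hmin },
    fun x => (hf x).trans (hle x), le_antisymm ((hf z).trans hqz) (apply_nonneg f z)⟩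

end Multiplicative

/-! ### Units of completions -/

theorem nontrivial_of_not_isUnit {M : Type*} [Monoid M] {a : M} (h : ¬ IsUnit a) :
    Nontrivial M :=
  not_subsingleton_iff_nontrivial.1 fun _ => h (isUnit_of_subsingleton a)

/-- An inverse in the completion can be approximated from the dense image of `A`. Conversely, the
Neumann series inverts `z * w`, and commutativity passes invertibility on to `z`. -/
theorem isUnit_coe_completion_iff {A : Type*} [SeminormedRing A] (hc : ∀ a b : A, a * b = b * a)
    (z : A) : IsUnit (z : UniformSpace.Completion A) ↔ ∃ w : A, ‖1 - z * w‖ < 1 := by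
  constructor
  · intro h
    obtain ⟨b, hb⟩ := h.exists_right_inv
    have hcont : Continuous fun w : UniformSpace.Completion A =>
        ‖1 - (z : UniformSpace.Completion A) * w‖ := by fun_prop
    have hopen : IsOpen {w : UniformSpace.Completion A |
        ‖1 - (z : UniformSpace.Completion A) * w‖ < 1} := isOpen_lt hcont continuous_const
    obtain ⟨w, hw⟩ := UniformSpace.Completion.denseRange_coe.exists_mem_open hopen
      ⟨b, by simp [hb]⟩
    refine ⟨w, ?_⟩
    rw [← UniformSpace.Completion.norm_coe]
    simpa [UniformSpace.Completion.coe_sub, UniformSpace.Completion.coe_mul,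
      UniformSpace.Completion.coe_one] using hw
  · rintro ⟨w, hw⟩
    have hcomm : Commute (z : UniformSpace.Completion A) w := by
      rw [Commute, SemiconjBy, ← UniformSpace.Completion.coe_mul, hc,
        UniformSpace.Completion.coe_mul]
    rw [← UniformSpace.Completion.norm_coe] at hw
    have := isUnit_one_sub_of_norm_lt_one hw
    rw [UniformSpace.Completion.coe_sub, UniformSpace.Completion.coe_one, sub_sub_cancel,
      UniformSpace.Completion.coe_mul] at this
    exact (hcomm.isUnit_mul_iff.1 this).1

/-! ### The spectra in terms of the tensor semi-norms -/

section Tensor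

variable {R : Type u} {S : Type v} [NormedRing R] [NormedRing S]

theorem projSeminorm_tmul_le (x : R) (y : S) : projSeminorm R S (x ⊗ₜ y) ≤ ‖x‖ * ‖y‖ :=
  infRingSeminorm_le ⟨Unit, inferInstance, fun _ => x, fun _ => y, by simp, by simp⟩

theorem ultraSeminorm_tmul_le (x : R) (y : S) : ultraSeminorm R S (x ⊗ₜ y) ≤ ‖x‖ * ‖y‖ :=
  infRingSeminorm_le ⟨Unit, inferInstance, fun _ => x, fun _ => y, by simp, by simp⟩

variable {L : Type*} [NormedRing L]

theorem norm_le_projSeminorm (μ : R ⊗[ℤ] S →+* L) (hμ : ∀ x y, ‖μ (x ⊗ₜ y)‖ ≤ ‖x‖ * ‖y‖)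
    (z : R ⊗[ℤ] S) : ‖μ z‖ ≤ projSeminorm R S z := by
  refine le_infRingSeminorm ?_
  rintro r ⟨ι, _, x, y, rfl, rfl⟩
  rw [map_sum]
  exact norm_sum_le_of_le _ fun i _ => hμ _ _

/-- The target must be ultrametric so that the norm of a sum is controlled by the maximum of the
terms. -/
theorem norm_le_ultraSeminorm [IsUltrametricDist L] (μ : R ⊗[ℤ] S →+* L)
    (hμ : ∀ x y, ‖μ (x ⊗ₜ y)‖ ≤ ‖x‖ * ‖y‖) (z : R ⊗[ℤ] S) : ‖μ z‖ ≤ ultraSeminorm R S z := by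
  refine le_infRingSeminorm ?_
  rintro r ⟨ι, _, x, y, rfl, rfl⟩
  rw [map_sum]
  refine IsUltrametricDist.norm_sum_le_of_forall_le_of_nonneg
    (Real.iSup_nonneg fun i => by positivity) fun i _ => (hμ _ _).trans ?_
  exact le_ciSup (f := fun i => ‖x i‖ * ‖y i‖) (Set.finite_range _).bddAbove i

end Tensor

section Spectra

variable {T : Type u} [NormedCommRing T]

/-- Non-triviality of the completed tensor product is automatic, since everything is a unit in the
zero ring. What remains is a condition on the uncompleted tensor product. -/
theorem mem_berSpectrum_iff {α : Cardinal.{u}} {u : T} {c : Scalars α} :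
    c ∈ berSpectrum α u ↔ ∃ x : PointedField α, Scalars.mk x = c ∧
      ∀ w : T ⊗[ℤ] x.carrier,
        1 ≤ projSeminorm T x.carrier (1 - ((1 : T) ⊗ₜ x.point - u ⊗ₜ (1 : x.carrier)) * w) := by
  refine exists_congr fun x => and_congr_right fun _ => ?_
  have h : CompletedTensor.tmul (1 : T) x.point - CompletedTensor.tmul u (1 : x.carrier) =
      ((show ProjTensor T x.carrier from
        ((1 : T) ⊗ₜ x.point - u ⊗ₜ (1 : x.carrier) : T ⊗[ℤ] x.carrier) :
        ProjTensor T x.carrier) : CompletedTensor T x.carrier) :=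
    (UniformSpace.Completion.coe_sub (α := ProjTensor T x.carrier) _ _).symm
  rw [and_iff_right_of_imp nontrivial_of_not_isUnit, h, isUnit_coe_completion_iff (A := ProjTensor T x.carrier)
    (fun a b => mul_comm (G := T ⊗[ℤ] x.carrier) a b)]
  push Not
  exact Iff.rfl

theorem mem_umSpectrum_iff {α : Cardinal.{u}} {u : T} {c : Scalars α} :
    c ∈ umSpectrum α u ↔ ∃ x : PointedField α, Scalars.mk x = c ∧
      ∀ w : T ⊗[ℤ] x.carrier,
        1 ≤ ultraSeminorm T x.carrier (1 - ((1 : T) ⊗ₜ x.point - u ⊗ₜ (1 : x.carrier)) * w) := by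
  refine exists_congr fun x => and_congr_right fun _ => ?_
  have h : CompletedUltraTensor.tmul (1 : T) x.point -
      CompletedUltraTensor.tmul u (1 : x.carrier) =
      ((show UltraTensor T x.carrier from
        ((1 : T) ⊗ₜ x.point - u ⊗ₜ (1 : x.carrier) : T ⊗[ℤ] x.carrier) :
        UltraTensor T x.carrier) : CompletedUltraTensor T x.carrier) :=
    (UniformSpace.Completion.coe_sub (α := UltraTensor T x.carrier) _ _).symm
  rw [and_iff_right_of_imp nontrivial_of_not_isUnit, h, isUnit_coe_completion_iff (A := UltraTensor T x.carrier)
    (fun a b => mul_comm (G := T ⊗[ℤ] x.carrier) a b)]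
  push Not
  exact Iff.rfl

/-- The pull-back of a multiplicative semi-norm along a ring homomorphism. -/
def comapSeminorm {A B : Type*} [CommRing A] [CommRing B] (g : MulRingSeminorm B) (k : A →+* B) :
    MulRingSeminorm A where
  toFun x := g (k x)
  map_zero' := by simp
  add_le' x y := by simpa using map_add_le_add g _ _
  neg' x := by simp
  map_one' := by simp
  map_mul' x y := by simp

/-- The difference `p(x) - p(y)` is a multiple of `x - y`, hence lies in the kernel of `g`. -/
theorem seminorm_aeval_eq {A : Type*} [CommRing A] (g : MulRingSeminorm A) {x y : A}
    (h : g (x - y) = 0) (p : ℤ[X]) : g (Polynomial.aeval x p) = g (Polynomial.aeval y p) := by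
  obtain ⟨q, hq⟩ := Polynomial.sub_dvd_eval_sub x y (p.map (algebraMap ℤ A))
  rw [Polynomial.eval_map_algebraMap, Polynomial.eval_map_algebraMap] at hq
  have h0 : g (Polynomial.aeval x p - Polynomial.aeval y p) = 0 := by
    rw [hq, map_mul, h, zero_mul]
  refine le_antisymm ?_ ?_
  · have := map_add_le_add g (Polynomial.aeval x p - Polynomial.aeval y p) (Polynomial.aeval y p)
    rwa [sub_add_cancel, h0, zero_add] at this
  · have := map_add_le_add g (Polynomial.aeval y p - Polynomial.aeval x p) (Polynomial.aeval x p)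
    rwa [sub_add_cancel, map_sub_rev, h0, zero_add] at this

/-! ### Passing between points of the spectra and characters or semi-norms of `T` -/

variable {K : Type*} [NormedField K]

/-- A contractive multiplicative semi-norm on a valuation field is the norm. -/
theorem mulRingSeminorm_eq_norm (f : MulRingSeminorm K) (hf : ∀ x, f x ≤ ‖x‖) (x : K) :
    f x = ‖x‖ := by
  refine le_antisymm (hf x) ?_
  rcases eq_or_ne x 0 with rfl | hx
  · simp
  have hmul : f x * f x⁻¹ = 1 := by rw [← map_mul, mul_inv_cancel₀ hx, map_one]
  have hx' : ‖x‖ * ‖x⁻¹‖ = 1 := by rw [← norm_mul, mul_inv_cancel₀ hx, norm_one]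
  refine le_of_mul_le_mul_right ?_ (norm_pos_iff.2 (inv_ne_zero hx))
  rw [hx', ← hmul]
  exact mul_le_mul_of_nonneg_left (hf _) (apply_nonneg _ _)

/-- If `1 ⊗ s - u ⊗ 1` is far from being invertible for a cross semi-norm, then some
`f ∈ 𝓜(T)` satisfies `f (p(u)) = ‖p(s)‖` for all integral polynomials `p`. -/
theorem exists_berkovichSpace_of_le [NormOneClass T] (u : T) (s : K)
    (N : RingSeminorm (T ⊗[ℤ] K)) (hN : ∀ x y, N (x ⊗ₜ y) ≤ ‖x‖ * ‖y‖)
    (h : ∀ w, 1 ≤ N (1 - ((1 : T) ⊗ₜ s - u ⊗ₜ (1 : K)) * w)) :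
    ∃ f : BerkovichSpace T, ∀ p : ℤ[X], f.1 (Polynomial.aeval u p) = ‖Polynomial.aeval s p‖ := by
  have h1 : N 1 ≤ 1 := (hN 1 1).trans_eq (by simp)
  obtain ⟨g, hgN, hg⟩ := exists_mulRingSeminorm_le N h1 _ h
  let i : T →ₐ[ℤ] T ⊗[ℤ] K := Algebra.TensorProduct.includeLeft
  let j : K →ₐ[ℤ] T ⊗[ℤ] K := Algebra.TensorProduct.includeRight
  -- Multiplicativity leaves no room in a field: a strict inequality at `y` would be reversed at its
  -- inverse.
  have hgK : ∀ y, g (j y) = ‖y‖ :=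
    mulRingSeminorm_eq_norm (comapSeminorm g j.toRingHom) fun y =>
      (hgN _).trans ((hN 1 y).trans_eq (by simp))
  refine ⟨⟨comapSeminorm g i.toRingHom, fun x => (hgN _).trans ((hN x 1).trans_eq (by simp))⟩,
    fun p => ?_⟩
  refine Eq.trans ?_ (hgK _)
  change g (i (Polynomial.aeval u p)) = g (j (Polynomial.aeval s p))
  rw [← Polynomial.aeval_algHom_apply i, ← Polynomial.aeval_algHom_apply j]
  exact (seminorm_aeval_eq g hg p).symm

/-- The ring homomorphism `x ⊗ y ↦ χ x * y`. -/
noncomputable def tensorEval (χ : T →+* K) : T ⊗[ℤ] K →+* K :=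
  (Algebra.TensorProduct.lift χ.toIntAlgHom (AlgHom.id ℤ K) fun _ _ => mul_comm _ _).toRingHom

theorem tensorEval_tmul (χ : T →+* K) (x : T) (y : K) : tensorEval χ (x ⊗ₜ y) = χ x * y := by
  exact Algebra.TensorProduct.lift_tmul _ _ _ _ _

/-- The element `1 ⊗ χ u - u ⊗ 1` is sent to `χ u - χ u = 0`, so the contractive map `tensorEval χ`
keeps `1` at distance at least `1` from the ideal it generates. -/
theorem tensorEval_one_sub (χ : T →+* K) (u : T) (w : T ⊗[ℤ] K) :
    tensorEval χ (1 - ((1 : T) ⊗ₜ χ u - u ⊗ₜ (1 : K)) * w) = 1 := by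
  simp [tensorEval_tmul]

theorem norm_tensorEval_tmul_le (χ : T →+* K) (hχ : ∀ t, ‖χ t‖ ≤ ‖t‖) (x : T) (y : K) :
    ‖tensorEval χ (x ⊗ₜ y)‖ ≤ ‖x‖ * ‖y‖ := by
  rw [tensorEval_tmul, norm_mul]
  exact mul_le_mul_of_nonneg_right (hχ x) (norm_nonneg y)

/-- A contractive character `χ : T → K` gives the point `(K, χ u)` of the spectrum. -/
theorem mk_mem_berSpectrum {α : Cardinal.{u}} (x : PointedField α) (χ : T →+* x.carrier)
    (hχ : ∀ t, ‖χ t‖ ≤ ‖t‖) (u : T) (hu : χ u = x.point) : Scalars.mk x ∈ berSpectrum α u := by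
  refine mem_berSpectrum_iff.2 ⟨x, rfl, fun w => ?_⟩
  have := norm_le_projSeminorm (tensorEval χ) (norm_tensorEval_tmul_le χ hχ)
    (1 - ((1 : T) ⊗ₜ χ u - u ⊗ₜ (1 : x.carrier)) * w)
  rwa [tensorEval_one_sub, norm_one, hu] at this

theorem mk_mem_umSpectrum {α : Cardinal.{u}} (x : PointedField α) [IsUltrametricDist x.carrier]
    (χ : T →+* x.carrier) (hχ : ∀ t, ‖χ t‖ ≤ ‖t‖) (u : T) (hu : χ u = x.point) :
    Scalars.mk x ∈ umSpectrum α u := by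
  refine mem_umSpectrum_iff.2 ⟨x, rfl, fun w => ?_⟩
  have := norm_le_ultraSeminorm (tensorEval χ) (norm_tensorEval_tmul_le χ hχ)
    (1 - ((1 : T) ⊗ₜ χ u - u ⊗ₜ (1 : x.carrier)) * w)
  rwa [tensorEval_one_sub, norm_one, hu] at this

theorem exists_phi_eq_of_mem_berSpectrum [NormOneClass T] {α : Cardinal.{u}} {u : T}
    {c : Scalars α} (hc : c ∈ berSpectrum α u) : ∃ f, Phi u f = c.toAffineLine := by
  obtain ⟨x, rfl, h⟩ := mem_berSpectrum_iff.1 hc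
  obtain ⟨f, hf⟩ := exists_berkovichSpace_of_le u x.point _ projSeminorm_tmul_le h
  exact ⟨f, Subtype.ext (DFunLike.ext _ _ hf)⟩

theorem exists_phi_eq_of_mem_umSpectrum [NormOneClass T] {α : Cardinal.{u}} {u : T}
    {c : Scalars α} (hc : c ∈ umSpectrum α u) : ∃ f, Phi u f = c.toAffineLine := by
  obtain ⟨x, rfl, h⟩ := mem_umSpectrum_iff.1 hc
  obtain ⟨f, hf⟩ := exists_berkovichSpace_of_le u x.point _ ultraSeminorm_tmul_le h
  exact ⟨f, Subtype.ext (DFunLike.ext _ _ hf)⟩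

end Spectra

/-! ### Completed residue fields -/

section ResidueField

/-- An absolute value on a domain extends to the fraction field. -/
theorem exists_absoluteValue_fractionRing {D : Type*} [CommRing D] [IsDomain D]
    (v : AbsoluteValue D ℝ) :
    ∃ w : AbsoluteValue (FractionRing D) ℝ, ∀ x, w (algebraMap D _ x) = v x := by
  have hv : ∀ y : nonZeroDivisors D, IsUnit (v.toMonoidWithZeroHom y) := fun y =>
    (v.ne_zero (nonZeroDivisors.coe_ne_zero y)).isUnit
  let w : FractionRing D →*₀ ℝ :=
    (IsLocalization.toLocalizationMap (nonZeroDivisors D) (FractionRing D)).lift₀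
      v.toMonoidWithZeroHom hv
  have hw : ∀ x, w (algebraMap D _ x) = v x := fun x =>
    (IsLocalization.toLocalizationMap (nonZeroDivisors D) (FractionRing D)).lift_eq hv x
  have hdiv : ∀ a b : D, w (algebraMap D _ a / algebraMap D _ b) = v a / v b := fun a b => by
    rw [map_div₀, hw, hw]
  have hfrac := IsFractionRing.div_surjective (A := D) (K := FractionRing D)
  refine ⟨⟨⟨w, map_mul w⟩, fun x => ?_, fun x => map_eq_zero w, fun x y => ?_⟩, hw⟩
  · obtain ⟨a, b, -, rfl⟩ := hfrac x
    change 0 ≤ w _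
    rw [hdiv]
    exact div_nonneg (v.nonneg _) (v.nonneg _)
  · obtain ⟨a, b, hb, rfl⟩ := hfrac x
    obtain ⟨c, d, hd, rfl⟩ := hfrac y
    have hb' := v.pos (nonZeroDivisors.ne_zero hb)
    have hd' := v.pos (nonZeroDivisors.ne_zero hd)
    change w _ ≤ w _ + w _
    rw [div_add_div _ _ (IsFractionRing.to_map_ne_zero_of_mem_nonZeroDivisors hb)
      (IsFractionRing.to_map_ne_zero_of_mem_nonZeroDivisors hd), ← map_mul, ← map_mul, ← map_mul,
      ← map_add, hdiv, hdiv, hdiv, div_add_div _ _ hb'.ne' hd'.ne', map_mul v b d]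
    refine div_le_div_of_nonneg_right ?_ (by positivity)
    rw [← map_mul, ← map_mul]
    exact v.add_le _ _

/-- The kernel of a multiplicative semi-norm. -/
def seminormKer {A : Type*} [CommRing A] (f : MulRingSeminorm A) : Ideal A where
  carrier := {x | f x = 0}
  add_mem' {x y} hx hy := le_antisymm
    ((map_add_le_add f x y).trans_eq (by rw [hx, hy, add_zero])) (apply_nonneg f _)
  zero_mem' := map_zero f
  smul_mem' c x hx := by
    change f (c * x) = 0
    rw [map_mul, hx, mul_zero]

instance isPrime_seminormKer {A : Type*} [CommRing A] (f : MulRingSeminorm A) :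
    (seminormKer f).IsPrime where
  ne_top' h := by
    have : f 1 = 0 := (Ideal.eq_top_iff_one _).1 h
    simp at this
  mem_or_mem' {x y} h := by
    have : f (x * y) = 0 := h
    rwa [map_mul, mul_eq_zero] at this

/-- The absolute value induced on the quotient by the kernel. -/
theorem exists_absoluteValue_quotient {A : Type*} [CommRing A] (f : MulRingSeminorm A) :
    ∃ v : AbsoluteValue (A ⧸ seminormKer f) ℝ, ∀ x, v (Ideal.Quotient.mk _ x) = f x := by
  have hle : ∀ x y, f (x - y) = 0 → f x ≤ f y := fun x y h => by
    have := map_add_le_add f (x - y) y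
    rwa [sub_add_cancel, h, zero_add] at this
  let v : A ⧸ seminormKer f → ℝ := Quotient.lift f fun x y h => by
    have h' : f (x - y) = 0 := (Submodule.quotientRel_def _).1 h
    exact le_antisymm (hle x y h') (hle y x (by rwa [map_sub_rev]))
  have hv : ∀ x, v (Ideal.Quotient.mk _ x) = f x := fun _ => rfl
  refine ⟨⟨⟨v, ?_⟩, ?_, ?_, ?_⟩, hv⟩
  · intro x y
    obtain ⟨x, rfl⟩ := Ideal.Quotient.mk_surjective x
    obtain ⟨y, rfl⟩ := Ideal.Quotient.mk_surjective y
    rw [← map_mul, hv, hv, hv, map_mul]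
  · intro x
    obtain ⟨x, rfl⟩ := Ideal.Quotient.mk_surjective x
    exact apply_nonneg f x
  · intro x
    obtain ⟨x, rfl⟩ := Ideal.Quotient.mk_surjective x
    rw [Ideal.Quotient.eq_zero_iff_mem]
    rfl
  · intro x y
    obtain ⟨x, rfl⟩ := Ideal.Quotient.mk_surjective x
    obtain ⟨y, rfl⟩ := Ideal.Quotient.mk_surjective y
    exact map_add_le_add f x y

/-- The completion of a space with at most `α` points has at most `α ^ ℵ₀` points. -/
theorem mk_completion_le (X : Type u) [PseudoMetricSpace X] :
    #(UniformSpace.Completion X) ≤ #X ^ (ℵ₀ : Cardinal.{u}) := by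
  have h : ∀ y : UniformSpace.Completion X, ∃ s : ℕ → X,
      Filter.Tendsto (fun n => (s n : UniformSpace.Completion X)) Filter.atTop (nhds y) := by
    intro y
    obtain ⟨s, hs, hy⟩ := mem_closure_iff_seq_limit.1
      (UniformSpace.Completion.denseRange_coe (α := X) y)
    choose t ht using hs
    exact ⟨t, by simpa only [ht] using hy⟩
  -- A point is recovered from its chosen sequence by uniqueness of limits, so points inject into
  -- sequences in `X`.
  choose s hs using h
  have hinj : Function.Injective s := fun y z hyz => by
    have hz := hs z
    rw [← hyz] at hz
    exact tendsto_nhds_unique (hs y) hz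
  simpa using Cardinal.mk_le_of_injective hinj

/-- Every multiplicative semi-norm is induced by a character with values in a complete
valuation field. -/
theorem exists_pointedField {α : Cardinal.{u}} (hα : ℵ₀ ≤ α) {T : Type u} [CommRing T]
    (hT : #T ≤ α) (f : MulRingSeminorm T) (u : T) :
    ∃ (x : PointedField α) (χ : T →+* x.carrier), (∀ t, ‖χ t‖ = f t) ∧ χ u = x.point := by
  obtain ⟨v, hv⟩ := exists_absoluteValue_quotient f
  obtain ⟨w, hw⟩ := exists_absoluteValue_fractionRing v
  let F := FractionRing (T ⧸ seminormKer f)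
  let _ : NormedField F := w.toNormedField
  let χ : T →+* UniformSpace.Completion F := UniformSpace.Completion.coeRingHom.comp
    ((algebraMap (T ⧸ seminormKer f) F).comp (Ideal.Quotient.mk _))
  refine ⟨⟨UniformSpace.Completion F, ?_, χ u⟩, χ, fun t => ?_, rfl⟩
  -- Completing may raise the cardinality to a countable power; this is where the bound `2 ^ α` is
  -- needed, as `(2 ^ α) ^ ℵ₀ = 2 ^ α`.
  · have hF : #F ≤ α := (Cardinal.mk_fractionRing _).trans_le
      ((Cardinal.mk_le_of_surjective Ideal.Quotient.mk_surjective).trans hT)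
    calc #(UniformSpace.Completion F) ≤ #F ^ (ℵ₀ : Cardinal.{u}) := mk_completion_le F
      _ ≤ (2 ^ α) ^ (ℵ₀ : Cardinal.{u}) :=
        Cardinal.power_le_power_right (hF.trans (Cardinal.cantor α).le)
      _ = 2 ^ α := by rw [← Cardinal.power_mul, Cardinal.mul_aleph0_eq hα]
  · change ‖((algebraMap (T ⧸ seminormKer f) F (Ideal.Quotient.mk _ t) : F) :
      UniformSpace.Completion F)‖ = f t
    rw [UniformSpace.Completion.norm_coe]
    exact (hw _).trans (hv t)

end ResidueField

/-! ### Injectivity of `Θ` -/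

section Injectivity

variable {K L : Type*} [NormedField K] [NormedField L]

/-- The pairs `(p(s)/q(s), p(t)/q(t))`. -/
def fractionPairs (s : K) (t : L) : Subring (K × L) where
  carrier := {z | ∃ p q : ℤ[X], Polynomial.aeval s q ≠ 0 ∧ Polynomial.aeval t q ≠ 0 ∧
    z = (Polynomial.aeval s p / Polynomial.aeval s q, Polynomial.aeval t p / Polynomial.aeval t q)}
  mul_mem' := by
    rintro _ _ ⟨p, q, h1, h2, rfl⟩ ⟨p', q', h1', h2', rfl⟩
    refine ⟨p * p', q * q', ?_, ?_, ?_⟩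
    · rw [map_mul]; exact mul_ne_zero h1 h1'
    · rw [map_mul]; exact mul_ne_zero h2 h2'
    · simp [div_mul_div_comm]
  one_mem' := ⟨1, 1, by simp, by simp, by simp [Prod.one_eq_mk]⟩
  add_mem' := by
    rintro _ _ ⟨p, q, h1, h2, rfl⟩ ⟨p', q', h1', h2', rfl⟩
    refine ⟨p * q' + q * p', q * q', ?_, ?_, ?_⟩
    · rw [map_mul]; exact mul_ne_zero h1 h1'
    · rw [map_mul]; exact mul_ne_zero h2 h2'
    · simp [div_add_div _ _ h1 h1', div_add_div _ _ h2 h2']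
  zero_mem' := ⟨0, 1, by simp, by simp, by simp [Prod.zero_eq_mk]⟩
  neg_mem' := by
    rintro _ ⟨p, q, h1, h2, rfl⟩
    exact ⟨-p, q, h1, h2, by simp [neg_div]⟩

theorem norm_eq_of_mem_closure {s : K} {t : L}
    (h : ∀ p : ℤ[X], ‖Polynomial.aeval s p‖ = ‖Polynomial.aeval t p‖) {z : K × L}
    (hz : z ∈ (fractionPairs s t).topologicalClosure) :
    ‖z.1‖ = ‖z.2‖ := by
  have hcl : IsClosed {z : K × L | ‖z.1‖ = ‖z.2‖} :=
    isClosed_eq (by fun_prop) (by fun_prop)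
  refine closure_minimal ?_ hcl hz
  rintro _ ⟨p, q, -, -, rfl⟩
  simp [h]

/-- Since the coordinates of a point of the closure have equal norms, either both vanish or
inversion is continuous there. On fraction pairs, inversion exchanges numerator and denominator, and
`p(s)` vanishes exactly when `p(t)` does. -/
theorem inv_mem_closure {s : K} {t : L}
    (h : ∀ p : ℤ[X], ‖Polynomial.aeval s p‖ = ‖Polynomial.aeval t p‖) {z : K × L}
    (hz : z ∈ (fractionPairs s t).topologicalClosure) :
    z⁻¹ ∈ (fractionPairs s t).topologicalClosure := by
  have hn := norm_eq_of_mem_closure h hz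
  rcases eq_or_ne z.1 0 with h1 | h1
  · have h2 : z.2 = 0 := by rw [h1, norm_zero] at hn; exact norm_eq_zero.1 hn.symm
    have : z = 0 := Prod.ext h1 h2
    rw [this, show (0 : K × L)⁻¹ = 0 from Prod.ext inv_zero inv_zero]
    exact zero_mem _
  · have h2 : z.2 ≠ 0 := by
      rw [← norm_pos_iff, ← hn]; exact norm_pos_iff.2 h1
    have hc : ContinuousAt (fun z : K × L => z⁻¹) z :=
      (continuousAt_fst.inv₀ h1).prodMk (continuousAt_snd.inv₀ h2)
    refine hc.continuousWithinAt.mem_closure hz ?_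
    rintro _ ⟨p, q, hq1, hq2, rfl⟩
    rcases eq_or_ne (Polynomial.aeval s p) 0 with hp | hp
    · have hp' : Polynomial.aeval t p = 0 := by rw [← norm_eq_zero, ← h, hp, norm_zero]
      exact ⟨0, 1, by simp, by simp, by simp [hp, hp']⟩
    · have hp' : Polynomial.aeval t p ≠ 0 := by
        rw [← norm_pos_iff, ← h]; exact norm_pos_iff.2 hp
      exact ⟨q, p, hp, hp', by simp⟩

/-- Two complete valuation fields with elements `s`, `t` such that `‖p(s)‖ = ‖p(t)‖` for all
integral polynomials `p` have a common complete subfield containing `s` and `t`. -/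
theorem exists_common_subfield [CompleteSpace K] [CompleteSpace L] (s : K) (t : L)
    (h : ∀ p : ℤ[X], ‖Polynomial.aeval s p‖ = ‖Polynomial.aeval t p‖) :
    ∃ (M : Subfield K) (_ : CompleteSpace M) (hs : s ∈ M) (g : M →+* L),
      (∀ z, ‖g z‖ = ‖z‖) ∧ g ⟨s, hs⟩ = t := by
  -- `D` is the graph of the isomorphism sought. Its coordinates have equal norms, so the projection
  -- to `K` is isometric: the image `M` is a closed subfield, and `g` is the second coordinate.
  let D := (fractionPairs s t).topologicalClosure
  have : CompleteSpace D := (fractionPairs s t).isClosed_topologicalClosure.completeSpace_coe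
  let π : D →+* K := (RingHom.fst K L).comp D.subtype
  have hπ : ∀ z : D, ‖π z‖ = ‖z‖ := fun z => by
    change ‖z.1.1‖ = max ‖z.1.1‖ ‖z.1.2‖
    rw [norm_eq_of_mem_closure h z.2, max_self]
  have hiso : Isometry π := AddMonoidHomClass.isometry_of_norm π hπ
  let M : Subfield K :=
    { π.range with
      inv_mem' := by
        rintro _ ⟨z, rfl⟩
        exact ⟨⟨_, inv_mem_closure h z.2⟩, rfl⟩ }
  let e : D ≃+* M := RingEquiv.ofBijective π.rangeRestrict
    ⟨fun a b hab => hiso.injective (congrArg Subtype.val hab), π.rangeRestrict_surjective⟩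
  have hM : IsClosed (M : Set K) := by
    change IsClosed (π.range : Set K)
    rw [RingHom.coe_range]
    exact hiso.isClosedEmbedding.isClosed_range
  have hst : (s, t) ∈ D := (fractionPairs s t).le_topologicalClosure
    ⟨Polynomial.X, 1, by simp, by simp, by simp⟩
  refine ⟨M, hM.completeSpace_coe, ⟨⟨_, hst⟩, rfl⟩,
    ((RingHom.snd K L).comp D.subtype).comp (e.symm : M →+* D), fun z => ?_, ?_⟩
  · obtain ⟨z, rfl⟩ := e.surjective z
    change ‖(e.symm (e z)).1.2‖ = ‖π z‖
    rw [e.symm_apply_apply]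
    exact (norm_eq_of_mem_closure h z.2).symm
  · change (e.symm (e ⟨_, hst⟩)).1.2 = t
    rw [e.symm_apply_apply]

theorem toAffineLine_injective (α : Cardinal.{u}) :
    Function.Injective (Scalars.toAffineLine (α := α)) := by
  intro a b hab
  induction a using Quotient.inductionOn with | h x
  induction b using Quotient.inductionOn with | h y
  have h : ∀ p : ℤ[X], ‖Polynomial.aeval x.point p‖ = ‖Polynomial.aeval y.point p‖ :=
    fun p => DFunLike.congr_fun (congrArg Subtype.val hab) p
  obtain ⟨M, _, hs, g, hg, hgt⟩ := exists_common_subfield x.point y.point h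
  exact Quotient.sound ⟨⟨M, (Cardinal.mk_le_of_injective Subtype.val_injective).trans x.card_le,
    ⟨x.point, hs⟩⟩, M.subtype, g, fun _ => le_rfl, fun z => (hg z).le, rfl, hgt⟩

end Injectivity

/-! ### The map `Φ_u` -/

section Phi

variable {T : Type u} [NormedCommRing T]

theorem abs_sub_le_norm_sub (f : BerkovichSpace T) (x y : T) : |f.1 x - f.1 y| ≤ ‖x - y‖ := by
  refine (abs_sub_le_iff.2 ⟨?_, ?_⟩).trans (f.2 (x - y))
  · have := map_add_le_add f.1 (x - y) y
    rw [sub_add_cancel] at this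
    linarith
  · have := map_add_le_add f.1 (y - x) x
    rw [sub_add_cancel, map_sub_rev] at this
    linarith

theorem exists_aeval_near {u : T} (hu : (Subring.closure {u}).topologicalClosure = ⊤) (x : T)
    {ε : ℝ} (hε : 0 < ε) : ∃ p : ℤ[X], ‖x - Polynomial.aeval u p‖ < ε := by
  have hx : x ∈ closure (Subring.closure {u} : Set T) := by
    have : x ∈ (Subring.closure {u}).topologicalClosure := hu ▸ Subring.mem_top x
    exact this
  obtain ⟨y, hy, hxy⟩ := Metric.mem_closure_iff.1 hx ε hε
  have hle : Subring.closure {u} ≤ (Polynomial.aeval (R := ℤ) u).toRingHom.range :=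
    Subring.closure_le.2 (Set.singleton_subset_iff.2 ⟨Polynomial.X, by simp⟩)
  obtain ⟨p, rfl⟩ := hle hy
  exact ⟨p, by rwa [dist_eq_norm] at hxy⟩

variable [NormOneClass T]

theorem continuous_phi (u : T) : Continuous (Phi u) :=
  continuous_induced_rng.2 (continuous_pi fun p =>
    (continuous_apply (Polynomial.aeval u p)).comp continuous_induced_dom)

/-- If `T` is topologically generated by `u`, then `Φ_u` is an embedding. -/
theorem isEmbedding_phi {u : T} (hu : (Subring.closure {u}).topologicalClosure = ⊤) :
    Topology.IsEmbedding (Phi u) := by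
  refine ⟨⟨le_antisymm (continuous_iff_le_induced.1 (continuous_phi u)) ?_⟩, fun f g hfg => ?_⟩
  · let _ : TopologicalSpace (BerkovichSpace T) := TopologicalSpace.induced (Phi u) inferInstance
    refine continuous_iff_le_induced.1 (continuous_pi fun x => ?_)
    -- Evaluation at `x` is a uniform limit of evaluations at `p(u)`: the error is at most `‖x -
    -- p(u)‖` for all `f` at once.
    refine continuous_of_uniform_approx_of_continuous fun V hV => ?_
    obtain ⟨ε, hε, hV⟩ := Metric.mem_uniformity_dist.1 hV
    obtain ⟨p, hp⟩ := exists_aeval_near hu x hε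
    refine ⟨fun f => (Phi u f).1 p, ?_, fun f => hV ?_⟩
    · exact ((continuous_apply p).comp (continuous_induced_dom
        (f := fun (f : AffineLine ℤ) (p : ℤ[X]) => f.1 p))).comp
        (continuous_induced_dom (f := Phi u))
    · exact (abs_sub_le_norm_sub f _ _).trans_lt hp
  · refine Subtype.ext (DFunLike.ext _ _ fun x => eq_of_forall_dist_le fun ε hε => ?_)
    obtain ⟨p, hp⟩ := exists_aeval_near hu x (half_pos hε)
    have hfg' : f.1 (Polynomial.aeval u p) = g.1 (Polynomial.aeval u p) :=
      DFunLike.congr_fun (congrArg Subtype.val hfg) p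
    calc dist (f.1 x) (g.1 x) ≤ dist (f.1 x) (f.1 (Polynomial.aeval u p)) +
          dist (f.1 (Polynomial.aeval u p)) (g.1 x) := dist_triangle _ _ _
      _ = |f.1 x - f.1 (Polynomial.aeval u p)| + |g.1 x - g.1 (Polynomial.aeval u p)| := by
          rw [hfg', dist_comm _ (g.1 x)]; simp [Real.dist_eq]
      _ ≤ ‖x - Polynomial.aeval u p‖ + ‖x - Polynomial.aeval u p‖ :=
          add_le_add (abs_sub_le_norm_sub _ _ _) (abs_sub_le_norm_sub _ _ _)
      _ ≤ ε := by linarith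

theorem nonempty_berkovichSpace (T : Type u) [NormedCommRing T] [NormOneClass T] :
    Nonempty (BerkovichSpace T) := by
  let N : RingSeminorm T :=
    { toFun := norm
      map_zero' := norm_zero
      add_le' := norm_add_le
      neg' := norm_neg
      mul_le' := norm_mul_le }
  -- The zero ideal already satisfies the distance condition.
  obtain ⟨f, hf, -⟩ := exists_mulRingSeminorm_le N (norm_one (α := T)).le 0 fun w => by
    rw [zero_mul, sub_zero]
    exact (norm_one (α := T)).ge
  exact ⟨⟨f, hf⟩⟩

variable {α : Cardinal.{u}}

theorem exists_mem_berSpectrum (hα : ℵ₀ ≤ α) (hT : #T ≤ α) (u : T) (f : BerkovichSpace T) :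
    ∃ c ∈ berSpectrum α u, c.toAffineLine = Phi u f := by
  obtain ⟨x, χ, hχ, hu⟩ := exists_pointedField hα hT f.1 u
  refine ⟨_, mk_mem_berSpectrum x χ (fun t => (hχ t).trans_le (f.2 t)) u hu,
    Subtype.ext (DFunLike.ext _ _ fun p => ?_)⟩
  change ‖Polynomial.aeval x.point p‖ = f.1 (Polynomial.aeval u p)
  rw [← hu, ← hχ]
  exact congrArg norm (Polynomial.aeval_algHom_apply χ.toIntAlgHom u p)

theorem exists_mem_umSpectrum (hα : ℵ₀ ≤ α) (hT : #T ≤ α)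
    (hum : ∀ x y : T, ‖x + y‖ ≤ max ‖x‖ ‖y‖) (u : T) (f : BerkovichSpace T) :
    ∃ c ∈ umSpectrum α u, c.toAffineLine = Phi u f := by
  obtain ⟨x, χ, hχ, hu⟩ := exists_pointedField hα hT f.1 u
  -- Integers have norm at most `1` in `T`, hence also in the residue field, which forces its norm
  -- to be ultrametric.
  have hn : ∀ n : ℕ, ‖(n : T)‖ ≤ 1 := fun n => by
    induction n with
    | zero => simp
    | succ n ih =>
      rw [Nat.cast_succ]
      exact (hum _ _).trans (max_le ih norm_one.le)
  have : IsUltrametricDist x.carrier :=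
    IsUltrametricDist.isUltrametricDist_of_forall_norm_natCast_le_one fun n => by
      rw [← map_natCast χ, hχ]
      exact (f.2 _).trans (hn n)
  refine ⟨_, mk_mem_umSpectrum x χ (fun t => (hχ t).trans_le (f.2 t)) u hu,
    Subtype.ext (DFunLike.ext _ _ fun p => ?_)⟩
  change ‖Polynomial.aeval x.point p‖ = f.1 (Polynomial.aeval u p)
  rw [← hu, ← hχ]
  exact congrArg norm (Polynomial.aeval_algHom_apply χ.toIntAlgHom u p)

theorem range_phi_eq_image_berSpectrum (hα : ℵ₀ ≤ α) (hT : #T ≤ α) (u : T) :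
    Set.range (Phi u) = Scalars.toAffineLine '' berSpectrum α u := by
  refine Set.Subset.antisymm ?_ ?_
  · rintro _ ⟨f, rfl⟩
    exact exists_mem_berSpectrum hα hT u f
  · rintro _ ⟨c, hc, rfl⟩
    exact exists_phi_eq_of_mem_berSpectrum hc

theorem range_phi_eq_image_umSpectrum (hα : ℵ₀ ≤ α) (hT : #T ≤ α)
    (hum : ∀ x y : T, ‖x + y‖ ≤ max ‖x‖ ‖y‖) (u : T) :
    Set.range (Phi u) = Scalars.toAffineLine '' umSpectrum α u := by
  refine Set.Subset.antisymm ?_ ?_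
  · rintro _ ⟨f, rfl⟩
    exact exists_mem_umSpectrum hα hT hum u f
  · rintro _ ⟨c, hc, rfl⟩
    exact exists_phi_eq_of_mem_umSpectrum hc

end Phi

end BanachSpec

/-! ### Assembling the three assertions -/

theorem mainTheorem2 (α : Cardinal.{u}) (hα : ℵ₀ ≤ α) (T : Type u) [NormedCommRing T]
    [NormOneClass T] [CompleteSpace T] (hT : #T ≤ α) (u : T) :
    (Continuous (BanachSpec.Phi u) ∧
      Set.range (BanachSpec.Phi u) =
        BanachSpec.Scalars.toAffineLine '' BanachSpec.berSpectrum α u ∧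
      (BanachSpec.berSpectrum α u).Nonempty) ∧
    ((Subring.closure {u}).topologicalClosure = ⊤ →
      ∃ e : BanachSpec.BerkovichSpace T ≃ₜ
          (BanachSpec.Scalars.toAffineLine '' BanachSpec.berSpectrum α u),
        ∀ f, (e f : BanachSpec.AffineLine ℤ) = BanachSpec.Phi u f) ∧
    ((∀ x y : T, ‖x + y‖ ≤ max ‖x‖ ‖y‖) →
      Set.range (BanachSpec.Phi u) =
        BanachSpec.Scalars.toAffineLine '' BanachSpec.umSpectrum α u ∧
      BanachSpec.umSpectrum α u = BanachSpec.berSpectrum α u) := by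
  have hber := BanachSpec.range_phi_eq_image_berSpectrum hα hT u
  refine ⟨⟨BanachSpec.continuous_phi u, hber, ?_⟩, fun hu => ?_, fun hum => ?_⟩
  · obtain ⟨f⟩ := BanachSpec.nonempty_berkovichSpace T
    obtain ⟨c, hc, -⟩ := BanachSpec.exists_mem_berSpectrum hα hT u f
    exact ⟨c, hc⟩
  · exact ⟨(BanachSpec.isEmbedding_phi hu).toHomeomorph.trans (Homeomorph.setCongr hber),
      fun _ => rfl⟩
  · have hultra := BanachSpec.range_phi_eq_image_umSpectrum hα hT hum u
    -- Both spectra have image `Φ_u(𝓜(T))` under the injective map `Θ`.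
    exact ⟨hultra, (BanachSpec.toAffineLine_injective α).image_injective (hultra.symm.trans hber)⟩
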